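/- Let $\mathcal V$ be a countably infinite set of variables. A term rewrite system (TRS) consists of a signature $\mathcal F$ (a set of function symbols, each with a fixed arity) and a set of rewrite rules $\ell \to r$, where $\ell$ and $r$ are terms over $\mathcal F$ and $\mathcal V$, $\ell$ is not a variable, and every variable of $r$ occurs in $\ell$. Its rewrite relation, on the set $\mathcal T(\mathcal F,\mathcal V)$ of terms over $\mathcal F$ and $\mathcal V$, replaces a subterm $\ell\sigma$ by $r\sigma$, for a rule $\ell\to r$ and a substitution $\sigma\colon\mathcal V\to\mathcal T(\mathcal F,\mathcal V)$. The TRS is confluent if, whenever $s \to^* t$ and $s \to^* u$ for its rewrite relation $\to$, there is a term $v$ with $t \to^* v$ and $u \to^* v$. **Theorem (Toyama).** Let $\mathcal R_1$ and $\mathcal R_2$ be TRSs over signatures $\mathcal F_1$ and $\mathcal F_2$, respectively, with $\mathcal F_1 \cap \mathcal F_2 = \varnothing$. If $\mathcal R_1$ and $\mathcal R_2$ are both confluent, then the TRS $\mathcal R_1 \cup \mathcal R_2$ over the signature $\mathcal F_1 \cup \mathcal F_2$ is confluent. -/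

import Mathlib

universe u v w

namespace TermRewriting

/-- Function symbols with their arities. The language `L` only serves as a universe of function
symbols; a signature is a set of such symbols. Relation symbols of `L` play no role. -/
abbrev Sym (L : FirstOrder.Language.{u, v}) : Type u := Σ n : ℕ, L.Functions n

variable {L : FirstOrder.Language.{u, v}} {V : Type w}

/-- `IsTermOver F t` says that `t ∈ T(F, V)`: every function symbol in `t` belongs to `F`. -/
def IsTermOver (F : Set (Sym L)) : L.Term V → Prop
  | .var _ => True
  | .func f ts => (⟨_, f⟩ : Sym L) ∈ F ∧ ∀ i, IsTermOver F (ts i)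

theorem IsTermOver.mono {F G : Set (Sym L)} (h : F ⊆ G) :
    ∀ {t : L.Term V}, IsTermOver F t → IsTermOver G t
  | .var _, _ => trivial
  | .func _ _, ht => ⟨h ht.1, fun i => IsTermOver.mono h (ht.2 i)⟩

open Classical in
/-- The set of variables occurring in a term. -/
noncomputable def vars (t : L.Term V) : Set V := ↑t.varFinset

variable (L V) in
/-- A term rewrite system: a signature together with a set of rewrite rules `ℓ → r` (pairs
`(ℓ, r)`) between terms over this signature, where `ℓ` is not a variable and every variable
of `r` occurs in `ℓ`. -/
structure TRS where
  sig : Set (Sym L)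
  rules : Set (L.Term V × L.Term V)
  lhs_over : ∀ ρ ∈ rules, IsTermOver sig ρ.1
  rhs_over : ∀ ρ ∈ rules, IsTermOver sig ρ.2
  lhs_not_var : ∀ ρ ∈ rules, ∀ x : V, ρ.1 ≠ .var x
  vars_subset : ∀ ρ ∈ rules, vars ρ.2 ⊆ vars ρ.1

/-- One rewrite step with a set of rules: an instance `ℓσ` of a left-hand side, at any position of
the term, is replaced by `rσ`. -/
inductive Step (R : Set (L.Term V × L.Term V)) : L.Term V → L.Term V → Prop
  | root {l r : L.Term V} (h : (l, r) ∈ R) (σ : V → L.Term V) : Step R (l.subst σ) (r.subst σ)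
  | arg {n : ℕ} (f : L.Functions n) (ts : Fin n → L.Term V) (i : Fin n) {t : L.Term V}
      (h : Step R (ts i) t) : Step R (.func f ts) (.func f (Function.update ts i t))

/-- A relation is confluent if `b *← a →* c` implies `b →* d *← c` for some `d`. -/
def Confluent {α : Type*} (r : α → α → Prop) : Prop :=
  ∀ a b c : α, Relation.ReflTransGen r a b → Relation.ReflTransGen r a c →
    Relation.Join (Relation.ReflTransGen r) b c

namespace TRS

/-- The terms over the signature of a TRS. -/
def Terms (R : TRS L V) : Type (max u w) := {t : L.Term V // IsTermOver R.sig t}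

/-- The rewrite relation of a TRS, on the terms over its signature. (As the terms before and after
the step are over the signature, and variables of `r` occur in `ℓ`, the substitution in the step
can always be taken to have values over the signature.) -/
def Rewrites (R : TRS L V) (s t : R.Terms) : Prop := Step R.rules s.1 t.1

/-- A TRS is confluent if its rewrite relation is. -/
def IsConfluent (R : TRS L V) : Prop := Confluent R.Rewrites

/-- The union of two TRSs: unite the signatures and the sets of rules. -/
def union (R₁ R₂ : TRS L V) : TRS L V where
  sig := R₁.sig ∪ R₂.sig
  rules := R₁.rules ∪ R₂.rules
  lhs_over := by
    rintro ρ (h | h)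
    · exact (R₁.lhs_over ρ h).mono Set.subset_union_left
    · exact (R₂.lhs_over ρ h).mono Set.subset_union_right
  rhs_over := by
    rintro ρ (h | h)
    · exact (R₁.rhs_over ρ h).mono Set.subset_union_left
    · exact (R₂.rhs_over ρ h).mono Set.subset_union_right
  lhs_not_var := by
    rintro ρ (h | h)
    · exact R₁.lhs_not_var ρ h
    · exact R₂.lhs_not_var ρ h
  vars_subset := by
    rintro ρ (h | h)
    · exact R₁.vars_subset ρ h
    · exact R₂.vars_subset ρ h

end TRS

end TermRewriting

/-! Split a term into its top layer of one colour and the aliens below it, which serve as the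
variables of the layer. Layers of colour `c` are rewritten by a confluent system, so joinability is
an equivalence relation on them. In each class a cheapest representative is chosen: it is a variable
if the class contains one, and it introduces no new variables (`vars_rep_subset`). Replacing layers
by representatives from the bottom up gives `nf`, an invariant of rewriting (`nf_eq_of_stepOn`). The
term need not rewrite to it.

The obstacle to arguing layer by layer is collapse: an alien may rewrite to a term with the colour
of the surrounding layer, and the layers fuse. In `Reduced` terms the root colours already agree
with those of the normal forms, so this cannot happen. Every term rewrites to a reduced one
(`exists_reduced`), and reduced terms with the same normal form are joinable (`join_of_reduced`):
aliens with equal normal forms are joined by induction on the number of layers, and then the top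
layers are joined by confluence of one system. Two reducts of a term are thus joined by reducing
both first. -/

namespace TermRewriting
open Relation FirstOrder.Language

/-! ### Variables, substitutions and signatures -/

section Terms

variable {L : FirstOrder.Language.{u, v}} {V W X : Type*}

@[simp]
theorem mem_vars_var {x y : V} : x ∈ vars (.var y : L.Term V) ↔ x = y := by
  simp [vars, Term.varFinset]

@[simp]
theorem mem_vars_func {n : ℕ} {f : L.Functions n} {ts : Fin n → L.Term V} {x : V} :
    x ∈ vars (.func f ts) ↔ ∃ i, x ∈ vars (ts i) := by
  simp [vars, Term.varFinset]

theorem finite_vars (t : L.Term V) : (vars t).Finite := Finset.finite_toSet _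

@[simp]
theorem subst_var (σ : V → L.Term W) (x : V) : (Term.var x : L.Term V).subst σ = σ x := rfl

@[simp]
theorem subst_func {n : ℕ} (f : L.Functions n) (ts : Fin n → L.Term V) (σ : V → L.Term W) :
    (Term.func f ts).subst σ = .func f fun i => (ts i).subst σ := rfl

theorem subst_subst (t : L.Term V) (σ : V → L.Term W) (τ : W → L.Term X) :
    (t.subst σ).subst τ = t.subst fun x => (σ x).subst τ := by
  induction t with
  | var x => rfl
  | func f ts ih => simp [ih]

theorem subst_congr {t : L.Term V} {σ τ : V → L.Term W} (h : ∀ x ∈ vars t, σ x = τ x) :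
    t.subst σ = t.subst τ := by
  induction t with
  | var x => exact h x (by simp)
  | func f ts ih =>
    simp only [subst_func, Term.func.injEq, heq_eq_eq, true_and]
    exact funext fun i => ih i fun x hx => h x (mem_vars_func.2 ⟨i, hx⟩)

theorem subst_eq_self {t : L.Term V} {σ : V → L.Term V} (h : ∀ x ∈ vars t, σ x = .var x) :
    t.subst σ = t := by
  induction t with
  | var x => exact h x (by simp)
  | func f ts ih =>
    simp only [subst_func, Term.func.injEq, heq_eq_eq, true_and]
    exact funext fun i => ih i fun x hx => h x (mem_vars_func.2 ⟨i, hx⟩)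

theorem mem_vars_subst {t : L.Term V} {σ : V → L.Term W} {y : W} :
    y ∈ vars (t.subst σ) ↔ ∃ x ∈ vars t, y ∈ vars (σ x) := by
  induction t with
  | var x => simp
  | func f ts ih =>
    simp only [subst_func, mem_vars_func, ih]
    exact ⟨fun ⟨i, x, hx, hy⟩ => ⟨x, ⟨i, hx⟩, hy⟩, fun ⟨x, ⟨i, hx⟩, hy⟩ => ⟨i, x, hx, hy⟩⟩

theorem isTermOver_func {F : Set (Sym L)} {n : ℕ} {f : L.Functions n} {ts : Fin n → L.Term V} :
    IsTermOver F (.func f ts) ↔ (⟨_, f⟩ : Sym L) ∈ F ∧ ∀ i, IsTermOver F (ts i) := Iff.rfl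

theorem isTermOver_subst {F : Set (Sym L)} {t : L.Term V} {σ : V → L.Term W}
    (ht : IsTermOver F t) :
    IsTermOver F (t.subst σ) ↔ ∀ x ∈ vars t, IsTermOver F (σ x) := by
  induction t with
  | var x => simp
  | func f ts ih =>
    simp only [subst_func, isTermOver_func, ht.1, true_and, mem_vars_func, forall_exists_index]
    exact ⟨fun h x i hx => (ih i (ht.2 i)).1 (h i) x hx,
      fun h i => (ih i (ht.2 i)).2 fun x hx => h x i hx⟩

end Terms

/-! ### Rewriting with an arbitrary set of variables -/

section StepOn

variable {L : FirstOrder.Language.{u, v}} {V W X : Type*}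

/-- One rewrite step with a set of rules over `V`, between terms over another set `W` of
variables. -/
inductive StepOn (R : Set (L.Term V × L.Term V)) : L.Term W → L.Term W → Prop
  | root {l r : L.Term V} (h : (l, r) ∈ R) (σ : V → L.Term W) : StepOn R (l.subst σ) (r.subst σ)
  | arg {n : ℕ} (f : L.Functions n) (ts : Fin n → L.Term W) (i : Fin n) {t : L.Term W}
      (h : StepOn R (ts i) t) : StepOn R (.func f ts) (.func f (Function.update ts i t))

theorem stepOn_iff_step {R : Set (L.Term V × L.Term V)} {s t : L.Term V} :
    StepOn R s t ↔ Step R s t := by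
  constructor <;> intro h
  · induction h with
    | root h σ => exact .root h σ
    | arg f ts i _ ih => exact .arg f ts i ih
  · induction h with
    | root h σ => exact .root h σ
    | arg f ts i _ ih => exact .arg f ts i ih

variable {R : Set (L.Term V × L.Term V)}

theorem StepOn.mono {R' : Set (L.Term V × L.Term V)} (hR : R ⊆ R') {s t : L.Term W}
    (h : StepOn R s t) : StepOn R' s t := by
  induction h with
  | root h σ => exact .root (hR h) σ
  | arg f ts i _ ih => exact .arg f ts i ih

theorem StepOn.subst {s t : L.Term W} (h : StepOn R s t) (τ : W → L.Term X) :
    StepOn R (s.subst τ) (t.subst τ) := by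
  induction h with
  | root h σ => simpa only [subst_subst] using StepOn.root h _
  | @arg n f ts i t _ ih =>
    have : (fun j => (Function.update ts i t j).subst τ)
        = Function.update (fun j => (ts j).subst τ) i (t.subst τ) := by
      ext j
      by_cases hj : j = i
      · subst hj; simp
      · simp [hj]
    rw [subst_func, subst_func, this]
    exact .arg f _ i ih

theorem reflTransGen_subst {s t : L.Term W} (h : ReflTransGen (StepOn R) s t)
    (τ : W → L.Term X) : ReflTransGen (StepOn R) (s.subst τ) (t.subst τ) :=
  h.lift (·.subst τ) fun _ _ h => h.subst τ

theorem reflTransGen_update {n : ℕ} (f : L.Functions n) (ts : Fin n → L.Term W) (i : Fin n)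
    {t : L.Term W} (h : ReflTransGen (StepOn R) (ts i) t) :
    ReflTransGen (StepOn R) (.func f ts) (.func f (Function.update ts i t)) := by
  induction h with
  | refl => simpa using ReflTransGen.refl
  | @tail b c _ hbc ih =>
    refine ih.tail ?_
    have := StepOn.arg (R := R) f (Function.update ts i b) i (t := c) (by simpa using hbc)
    simpa using this

theorem reflTransGen_func {n : ℕ} (f : L.Functions n) {ts us : Fin n → L.Term W}
    (h : ∀ i, ReflTransGen (StepOn R) (ts i) (us i)) :
    ReflTransGen (StepOn R) (.func f ts) (.func f us) := by
  have key (A : Finset (Fin n)) :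
      ReflTransGen (StepOn R) (.func f ts) (.func f (A.piecewise us ts)) := by
    induction A using Finset.induction_on with
    | empty => simpa using ReflTransGen.refl
    | insert j A hj ih =>
      rw [Finset.piecewise_insert]
      exact ih.trans (reflTransGen_update f _ j (by simpa [hj] using h j))
  simpa using key Finset.univ

theorem reflTransGen_subst_subst {t : L.Term W} {σ τ : W → L.Term X}
    (h : ∀ x ∈ vars t, ReflTransGen (StepOn R) (σ x) (τ x)) :
    ReflTransGen (StepOn R) (t.subst σ) (t.subst τ) := by
  induction t with
  | var x => exact h x (by simp)
  | func f ts ih =>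
    exact reflTransGen_func f fun i => ih i fun x hx => h x (mem_vars_func.2 ⟨i, hx⟩)

theorem StepOn.vars_subset (hR : ∀ ρ ∈ R, vars ρ.2 ⊆ vars ρ.1) {s t : L.Term W}
    (h : StepOn R s t) : vars t ⊆ vars s := by
  induction h with
  | root h σ =>
    intro y hy
    obtain ⟨x, hx, hy⟩ := mem_vars_subst.1 hy
    exact mem_vars_subst.2 ⟨x, hR _ h hx, hy⟩
  | arg f ts i _ ih =>
    intro y hy
    obtain ⟨j, hj⟩ := mem_vars_func.1 hy
    by_cases hji : j = i
    · subst hji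
      exact mem_vars_func.2 ⟨j, ih (by simpa using hj)⟩
    · exact mem_vars_func.2 ⟨j, by simpa [hji] using hj⟩

theorem vars_subset_of_reflTransGen (hR : ∀ ρ ∈ R, vars ρ.2 ⊆ vars ρ.1) {s t : L.Term W}
    (h : ReflTransGen (StepOn R) s t) : vars t ⊆ vars s := by
  induction h with
  | refl => rfl
  | tail _ h ih => exact (h.vars_subset hR).trans ih

theorem StepOn.isTermOver {F : Set (Sym L)} (hR : ∀ ρ ∈ R, vars ρ.2 ⊆ vars ρ.1)
    (hl : ∀ ρ ∈ R, IsTermOver F ρ.1) (hr : ∀ ρ ∈ R, IsTermOver F ρ.2) {s t : L.Term W}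
    (h : StepOn R s t) (hs : IsTermOver F s) : IsTermOver F t := by
  induction h with
  | root h σ =>
    rw [isTermOver_subst (hl _ h)] at hs
    exact (isTermOver_subst (hr _ h)).2 fun x hx => hs x (hR _ h hx)
  | arg f ts i _ ih =>
    refine ⟨hs.1, fun j => ?_⟩
    by_cases hj : j = i
    · subst hj
      simpa using ih (hs.2 j)
    · simpa [hj] using hs.2 j

theorem isTermOver_of_reflTransGen {F : Set (Sym L)} (hR : ∀ ρ ∈ R, vars ρ.2 ⊆ vars ρ.1)
    (hl : ∀ ρ ∈ R, IsTermOver F ρ.1) (hr : ∀ ρ ∈ R, IsTermOver F ρ.2) {s t : L.Term W}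
    (h : ReflTransGen (StepOn R) s t) (hs : IsTermOver F s) : IsTermOver F t := by
  induction h with
  | refl => exact hs
  | tail _ h ih => exact h.isTermOver hR hl hr ih

theorem not_stepOn_var (hR : ∀ ρ ∈ R, ∀ x, ρ.1 ≠ .var x) {x : W} {t : L.Term W} :
    ¬ StepOn R (.var x) t := by
  generalize hs : (.var x : L.Term W) = s
  rintro (⟨h, σ⟩ | _)
  · rename_i l r
    cases l with
    | var y => exact hR _ h y rfl
    | func f ts => cases hs
  · cases hs

theorem eq_var_of_reflTransGen (hR : ∀ ρ ∈ R, ∀ x, ρ.1 ≠ .var x) {x : W} {t : L.Term W}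
    (h : ReflTransGen (StepOn R) (.var x) t) : t = .var x := by
  induction h with
  | refl => rfl
  | tail _ h ih => subst ih; exact (not_stepOn_var hR h).elim

/-- Confluence of a set of rules on the terms over a signature, with variables in `W`. -/
def ConfluentOver (F : Set (Sym L)) (R : Set (L.Term V × L.Term V)) (W : Type*) : Prop :=
  ∀ a b c : L.Term W, IsTermOver F a → ReflTransGen (StepOn R) a b →
    ReflTransGen (StepOn R) a c → Join (ReflTransGen (StepOn R)) b c

/-- Confluence does not depend on the set of variables, as long as there are infinitely many. -/
theorem ConfluentOver.of_infinite [Infinite V] [Nonempty W] {F : Set (Sym L)}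
    (hR : ∀ ρ ∈ R, vars ρ.2 ⊆ vars ρ.1) (h : ConfluentOver F R V) : ConfluentOver F R W := by
  intro a b c ha hab hac
  -- Only the finitely many variables of `a` occur in its reducts. Rename them injectively into `V`,
  -- join there, and rename back.
  obtain ⟨ρ, -, hρ⟩ := (finite_vars a).exists_injOn_of_encard_le (t := (Set.univ : Set V))
    (by simp)
  have back {t : L.Term W} (ht : vars t ⊆ vars a) :
      (t.subst fun x => (.var (ρ x) : L.Term V)).subst
        (fun y => .var (Function.invFunOn ρ (vars a) y)) = t := by
    rw [subst_subst]
    exact subst_eq_self fun x hx => congrArg _ (hρ.leftInvOn_invFunOn (ht hx))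
  obtain ⟨d, hbd, hcd⟩ := h _ _ _ ((isTermOver_subst ha).2 fun x _ => by simp [IsTermOver])
    (reflTransGen_subst hab fun x => .var (ρ x)) (reflTransGen_subst hac fun x => .var (ρ x))
  refine ⟨d.subst fun y => .var (Function.invFunOn ρ (vars a) y), ?_, ?_⟩
  · simpa only [back (vars_subset_of_reflTransGen hR hab)] using reflTransGen_subst hbd
      fun y => .var (Function.invFunOn ρ (vars a) y)
  · simpa only [back (vars_subset_of_reflTransGen hR hac)] using reflTransGen_subst hcd
      fun y => .var (Function.invFunOn ρ (vars a) y)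

theorem TRS.isConfluent_iff {R : TRS L V} :
    R.IsConfluent ↔ ConfluentOver R.sig R.rules V := by
  have hstep : (StepOn R.rules : L.Term V → L.Term V → Prop) = Step R.rules := by
    ext s t; exact stepOn_iff_step
  have hover {s t : L.Term V} (h : ReflTransGen (Step R.rules) s t) (hs : IsTermOver R.sig s) :
      IsTermOver R.sig t :=
    isTermOver_of_reflTransGen R.vars_subset R.lhs_over R.rhs_over (hstep ▸ h) hs
  have up {s t : L.Term V} (h : ReflTransGen (Step R.rules) s t) (hs : IsTermOver R.sig s) :
      ReflTransGen R.Rewrites ⟨s, hs⟩ ⟨t, hover h hs⟩ := by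
    induction h with
    | refl => exact .refl
    | tail h₁ h₂ ih => exact ih.tail h₂
  have down {s t : R.Terms} (h : ReflTransGen R.Rewrites s t) :
      ReflTransGen (Step R.rules) s.1 t.1 := h.lift Subtype.val fun _ _ h => h
  rw [ConfluentOver, hstep]
  constructor
  · intro h a b c ha hab hac
    obtain ⟨d, hbd, hcd⟩ := h _ _ _ (up hab ha) (up hac ha)
    exact ⟨d.1, down hbd, down hcd⟩
  · intro h a b c hab hac
    obtain ⟨d, hbd, hcd⟩ := h _ _ _ a.2 (down hab) (down hac)
    exact ⟨⟨d, hover hbd b.2⟩, up hbd b.2, up hcd c.2⟩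

end StepOn

/-- A family of confluent sets of rules over pairwise disjoint signatures; the signatures are given
by a colouring of the function symbols. -/
structure ColouredSystem (L : FirstOrder.Language.{u, v}) (V : Type w) (ι : Type*) where
  colour : Sym L → ι
  rules : ι → Set (L.Term V × L.Term V)
  lhs_over : ∀ c, ∀ ρ ∈ rules c, IsTermOver {f | colour f = c} ρ.1
  rhs_over : ∀ c, ∀ ρ ∈ rules c, IsTermOver {f | colour f = c} ρ.2
  lhs_not_var : ∀ c, ∀ ρ ∈ rules c, ∀ x : V, ρ.1 ≠ .var x
  vars_subset : ∀ c, ∀ ρ ∈ rules c, vars ρ.2 ⊆ vars ρ.1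
  confluent : ∀ c, ConfluentOver {f | colour f = c} (rules c) (L.Term V)

namespace ColouredSystem

variable {L : FirstOrder.Language.{u, v}} {V : Type w} {ι : Type*} (S : ColouredSystem L V ι)

/-! ### Layers -/

section Layers

variable {X : Type*}

/-- The term consists of symbols of colour `c` and variables only. -/
abbrev Pure (c : ι) (t : L.Term X) : Prop := IsTermOver {f | S.colour f = c} t

/-- The root of the term is a function symbol of colour `c`. -/
def Rooted (c : ι) : L.Term V → Prop
  | .var _ => False
  | .func f _ => S.colour ⟨_, f⟩ = c

@[simp] theorem not_rooted_var {c : ι} {x : V} : ¬ S.Rooted c (.var x) := id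

@[simp] theorem rooted_func {c : ι} {n : ℕ} {f : L.Functions n} {ts : Fin n → L.Term V} :
    S.Rooted c (.func f ts) ↔ S.colour ⟨_, f⟩ = c := Iff.rfl

open Classical in
/-- The top layer of colour `c` of a term; its variables are the maximal subterms whose root does
not have colour `c`. -/
noncomputable def cap (c : ι) : L.Term V → L.Term (L.Term V)
  | .var x => .var (.var x)
  | .func f ts => if S.colour ⟨_, f⟩ = c then .func f fun i => cap c (ts i) else .var (.func f ts)

variable {S} {c d : ι}

theorem cap_of_not_rooted {t : L.Term V} (h : ¬ S.Rooted c t) : S.cap c t = .var t := by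
  cases t with
  | var x => rfl
  | func f ts => exact if_neg h

theorem cap_func {n : ℕ} {f : L.Functions n} {ts : Fin n → L.Term V}
    (h : S.colour ⟨_, f⟩ = c) : S.cap c (.func f ts) = .func f fun i => S.cap c (ts i) :=
  if_pos h

theorem flatten_cap (t : L.Term V) : (S.cap c t).subst id = t := by
  induction t with
  | var x => rfl
  | func f ts ih =>
    by_cases h : S.Rooted c (.func f ts)
    · simp [cap_func h, ih]
    · simp [cap_of_not_rooted h]

theorem pure_cap (t : L.Term V) : S.Pure c (S.cap c t) := by
  induction t with
  | var x => trivial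
  | func f ts ih =>
    by_cases h : S.Rooted c (.func f ts)
    · rw [cap_func h]
      exact ⟨h, ih⟩
    · rw [cap_of_not_rooted h]
      trivial

theorem not_rooted_of_mem_vars_cap {t a : L.Term V} (ha : a ∈ vars (S.cap c t)) :
    ¬ S.Rooted c a := by
  induction t with
  | var x =>
    rw [cap_of_not_rooted (by simp), mem_vars_var] at ha
    simp [ha]
  | func f ts ih =>
    by_cases h : S.Rooted c (.func f ts)
    · rw [cap_func h] at ha
      obtain ⟨i, hi⟩ := mem_vars_func.1 ha
      exact ih i hi
    · rw [cap_of_not_rooted h, mem_vars_var] at ha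
      rwa [ha]

theorem cap_subst {p : L.Term X} (hp : S.Pure c p) (σ : X → L.Term V) :
    S.cap c (p.subst σ) = p.subst fun x => S.cap c (σ x) := by
  induction p with
  | var x => rfl
  | func f ts ih =>
    rw [subst_func, cap_func hp.1, subst_func]
    exact congrArg _ (funext fun i => ih i (hp.2 i))

theorem cap_flatten {p : L.Term (L.Term V)} (hp : S.Pure c p)
    (h : ∀ a ∈ vars p, ¬ S.Rooted c a) : S.cap c (p.subst id) = p := by
  rw [cap_subst hp]
  exact subst_eq_self fun a ha => cap_of_not_rooted (h a ha)

/-- A step in the layer only copies or erases aliens; a step inside an alien may expose the aliens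
of its reduct, if that collapses to colour `c`. -/
theorem exists_mem_vars_cap_of_stepOn {s t : L.Term V} (h : StepOn (⋃ d, S.rules d) s t)
    {b : L.Term V} (hb : b ∈ vars (S.cap c t)) :
    ∃ a ∈ vars (S.cap c s), a = b ∨
      ∃ b', StepOn (⋃ d, S.rules d) a b' ∧ b ∈ vars (S.cap c b') := by
  by_cases hs : S.Rooted c s
  swap
  · exact ⟨s, by simp [cap_of_not_rooted hs], .inr ⟨t, h, hb⟩⟩
  induction h with
  | @root l r hlr σ =>
    obtain ⟨d, hd⟩ := Set.mem_iUnion.1 hlr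
    have hl := S.lhs_over d _ hd
    obtain rfl : d = c := by
      cases l with
      | var x => exact (S.lhs_not_var d _ hd x rfl).elim
      | func f ts => exact hl.1.symm.trans hs
    rw [cap_subst (S.rhs_over d _ hd), mem_vars_subst] at hb
    obtain ⟨x, hx, hb⟩ := hb
    rw [cap_subst hl]
    exact ⟨b, mem_vars_subst.2 ⟨x, S.vars_subset d _ hd hx, hb⟩, .inl rfl⟩
  | @arg n f ts i t h ih =>
    rw [cap_func hs] at hb ⊢
    obtain ⟨j, hj⟩ := mem_vars_func.1 hb
    by_cases hji : j = i
    · subst hji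
      rw [Function.update_self] at hj
      by_cases hr : S.Rooted c (ts j)
      · obtain ⟨a, ha, hab⟩ := ih hj hr
        exact ⟨a, mem_vars_func.2 ⟨j, ha⟩, hab⟩
      · exact ⟨ts j, mem_vars_func.2 ⟨j, by simp [cap_of_not_rooted hr]⟩, .inr ⟨t, h, hj⟩⟩
    · rw [Function.update_of_ne hji] at hj
      exact ⟨b, mem_vars_func.2 ⟨j, hj⟩, .inl rfl⟩

end Layers

/-! ### Representatives of joinability classes of layers -/

section Representatives

/-- Joinability of two layers by the rules of colour `c`. -/
def Joinable (c : ι) (p q : L.Term (L.Term V)) : Prop :=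
  Join (ReflTransGen (StepOn (S.rules c))) p q

/-- The layers of colour `c` that are joinable with `p`. -/
def joinClass (c : ι) (p : L.Term (L.Term V)) : Set (L.Term (L.Term V)) :=
  {q | S.Pure c q ∧ S.Joinable c p q}

/-- Variables have cost zero, other terms are compared by the number of their variables. -/
noncomputable def cost {X : Type*} : L.Term X → ℕ
  | .var _ => 0
  -- The `+ 1` makes even a ground term costlier than a variable.
  | .func f ts => (vars (.func f ts : L.Term X)).ncard + 1

/-- A representative of minimal cost of the layers that are joinable with `p`. -/
noncomputable def rep (c : ι) (p : L.Term (L.Term V)) : L.Term (L.Term V) :=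
  @Classical.epsilon _ ⟨p⟩ (MinimalFor (· ∈ S.joinClass c p) cost)

variable {S} {c : ι} {p q r : L.Term (L.Term V)}

theorem Joinable.symm (h : S.Joinable c p q) : S.Joinable c q p := by
  obtain ⟨d, h₁, h₂⟩ := h
  exact ⟨d, h₂, h₁⟩

theorem Joinable.trans (hq : S.Pure c q) (h₁ : S.Joinable c p q) (h₂ : S.Joinable c q r) :
    S.Joinable c p r := by
  obtain ⟨d, hpd, hqd⟩ := h₁
  obtain ⟨e, hqe, hre⟩ := h₂
  obtain ⟨k, hdk, hek⟩ := S.confluent c _ _ _ hq hqd hqe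
  exact ⟨k, hpd.trans hdk, hre.trans hek⟩

theorem joinable_of_reflTransGen (h : ReflTransGen (StepOn (S.rules c)) p q) :
    S.Joinable c p q := ⟨q, h, .refl⟩

theorem Joinable.func {n : ℕ} (f : L.Functions n) {ps qs : Fin n → L.Term (L.Term V)}
    (h : ∀ i, S.Joinable c (ps i) (qs i)) : S.Joinable c (.func f ps) (.func f qs) := by
  choose ds h₁ h₂ using h
  exact ⟨.func f ds, reflTransGen_func f h₁, reflTransGen_func f h₂⟩

theorem Joinable.reflTransGen_var {a : L.Term V} (h : S.Joinable c p (.var a)) :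
    ReflTransGen (StepOn (S.rules c)) p (.var a) := by
  obtain ⟨d, hp, ha⟩ := h
  rwa [eq_var_of_reflTransGen (S.lhs_not_var c) ha] at hp

theorem minimalFor_rep (hp : S.Pure c p) :
    MinimalFor (· ∈ S.joinClass c p) cost (S.rep c p) := by
  have hne : (S.joinClass c p).Nonempty := ⟨p, hp, joinable_of_reflTransGen .refl⟩
  exact Classical.epsilon_spec (p := MinimalFor (· ∈ S.joinClass c p) cost)
    ⟨_, Function.isMinimalFor_argminOn cost _ hne⟩

theorem pure_rep (hp : S.Pure c p) : S.Pure c (S.rep c p) := (minimalFor_rep hp).1.1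

theorem joinable_rep (hp : S.Pure c p) : S.Joinable c p (S.rep c p) := (minimalFor_rep hp).1.2

theorem rep_eq_rep (hp : S.Pure c p) (hq : S.Pure c q) (h : S.Joinable c p q) :
    S.rep c p = S.rep c q := by
  have : S.joinClass c p = S.joinClass c q := by
    ext k
    exact and_congr_right fun _ => ⟨h.symm.trans hp, h.trans hq⟩
  simp only [rep, this]

theorem rep_rep (hp : S.Pure c p) : S.rep c (S.rep c p) = S.rep c p :=
  (rep_eq_rep hp (pure_rep hp) (joinable_rep hp)).symm

theorem joinable_of_rep_eq_rep (hp : S.Pure c p) (hq : S.Pure c q)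
    (h : S.rep c p = S.rep c q) : S.Joinable c p q :=
  (joinable_rep hp).trans (pure_rep hp) (h ▸ (joinable_rep hq).symm)

/-- Minimal cost forces a variable, and joinable variables are equal because variables are
irreducible. -/
theorem rep_var (a : L.Term V) : S.rep c (.var a) = .var a := by
  have ha : S.Pure c (.var a) := by trivial
  have hle := (minimalFor_rep ha).2 ⟨ha, joinable_of_reflTransGen .refl⟩ (by simp [cost])
  have hj := (joinable_rep ha).symm.reflTransGen_var
  cases h : S.rep c (.var a) with
  | var b =>
    rw [h] at hj
    exact (eq_var_of_reflTransGen (S.lhs_not_var c) hj).symm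
  | func f ts => simp [h, cost] at hle

/-- The layer and its representative have a common reduct. By minimality, that reduct has lost no
variable of the representative; and all its variables come from the original layer. -/
theorem vars_rep_subset (hp : S.Pure c p) : vars (S.rep c p) ⊆ vars p := by
  obtain ⟨k, hpk, hrk⟩ := joinable_rep hp
  have hk : S.Pure c k := isTermOver_of_reflTransGen (S.vars_subset c) (S.lhs_over c)
    (S.rhs_over c) hpk hp
  have hkp := vars_subset_of_reflTransGen (S.vars_subset c) hpk
  have hkr := vars_subset_of_reflTransGen (S.vars_subset c) hrk
  have hmin : cost k ≤ cost (S.rep c p) → cost (S.rep c p) ≤ cost k := fun h =>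
    (minimalFor_rep hp).2 ⟨hk, joinable_of_reflTransGen hpk⟩ h
  refine subset_trans ?_ hkp
  cases hr : S.rep c p with
  | var a =>
    rw [hr] at hrk
    rw [eq_var_of_reflTransGen (S.lhs_not_var c) hrk]
  | func f ts =>
    rw [hr] at hkr hmin
    have hcard := Set.ncard_le_ncard hkr (finite_vars _)
    cases k with
    | var a => simp [cost] at hmin
    | func g us =>
      simp only [cost] at hmin
      exact (Set.eq_of_subset_of_ncard_le hkr (by omega) (finite_vars _)).ge

end Representatives

/-! ### Normal forms for convertibility -/

/-- The normal form of a term: bottom up, every layer is replaced by its representative. -/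
noncomputable def nf : L.Term V → L.Term V
  | .var x => .var x
  | .func f ts => (S.rep (S.colour ⟨_, f⟩)
      (.func f fun i => S.cap (S.colour ⟨_, f⟩) (nf (ts i)))).subst id

/-- All layers of the term are representatives. -/
inductive Canonical : L.Term V → Prop
  | var (x : V) : Canonical (.var x)
  | layer {c : ι} {t : L.Term V} (hc : S.Rooted c t) (ht : S.rep c (S.cap c t) = S.cap c t)
      (h : ∀ a ∈ vars (S.cap c t), Canonical a) : Canonical t

variable {S} {c d : ι}

theorem Rooted.unique {t : L.Term V} (hc : S.Rooted c t) (hd : S.Rooted d t) : c = d := by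
  cases t with
  | var x => exact hc.elim
  | func f ts => exact hc.symm.trans hd

theorem rooted_subst {X : Type*} {n : ℕ} {f : L.Functions n} {ts : Fin n → L.Term X}
    {σ : X → L.Term V} (h : S.Pure c (.func f ts)) : S.Rooted c ((Term.func f ts).subst σ) := h.1

theorem Canonical.rep_cap {t : L.Term V} (h : S.Canonical t) :
    S.rep c (S.cap c t) = S.cap c t := by
  by_cases hc : S.Rooted c t
  · cases h with
    | var x => exact hc.elim
    | layer hd ht _ => exact hc.unique hd ▸ ht
  · rw [cap_of_not_rooted hc, rep_var]

theorem Canonical.of_mem_vars_cap {t a : L.Term V} (h : S.Canonical t)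
    (ha : a ∈ vars (S.cap c t)) : S.Canonical a := by
  by_cases hc : S.Rooted c t
  · cases h with
    | var x => exact hc.elim
    | layer hd _ h =>
      obtain rfl := hc.unique hd
      exact h a ha
  · rw [cap_of_not_rooted hc, mem_vars_var] at ha
    exact ha ▸ h

theorem cap_flatten_rep {p : L.Term (L.Term V)} (hp : S.Pure c p)
    (h : ∀ a ∈ vars p, ¬ S.Rooted c a) : S.cap c ((S.rep c p).subst id) = S.rep c p :=
  cap_flatten (pure_rep hp) fun a ha => h a (vars_rep_subset hp ha)

theorem canonical_flatten_rep {p : L.Term (L.Term V)} (hp : S.Pure c p)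
    (h : ∀ a ∈ vars p, ¬ S.Rooted c a) (hcan : ∀ a ∈ vars p, S.Canonical a) :
    S.Canonical ((S.rep c p).subst id) := by
  have hcap := cap_flatten_rep hp h
  have hvars := vars_rep_subset hp
  have hpure := pure_rep hp
  have hrep := rep_rep hp
  revert hcap hvars hpure hrep
  generalize S.rep c p = r
  intro hcap hvars hpure hrep
  cases r with
  | var a => exact hcan a (hvars (by simp))
  | func f ts =>
    refine .layer (rooted_subst hpure) (by rw [hcap, hrep]) fun a ha => ?_
    rw [hcap] at ha
    exact hcan a (hvars ha)

theorem pure_func_cap {n : ℕ} {f : L.Functions n} {ts : Fin n → L.Term V}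
    (h : S.colour ⟨_, f⟩ = c) : S.Pure c (.func f fun i => S.cap c (ts i)) :=
  ⟨h, fun _ => pure_cap _⟩

theorem not_rooted_of_mem_vars_func_cap {n : ℕ} {f : L.Functions n} {ts : Fin n → L.Term V}
    {a : L.Term V} (ha : a ∈ vars (.func f fun i => S.cap c (ts i))) : ¬ S.Rooted c a := by
  obtain ⟨i, hi⟩ := mem_vars_func.1 ha
  exact not_rooted_of_mem_vars_cap hi

theorem canonical_nf (t : L.Term V) : S.Canonical (S.nf t) := by
  induction t with
  | var x => exact .var x
  | func f ts ih =>
    refine canonical_flatten_rep (pure_func_cap rfl)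
      (fun a => not_rooted_of_mem_vars_func_cap) fun a ha => ?_
    obtain ⟨i, hi⟩ := mem_vars_func.1 ha
    exact (ih i).of_mem_vars_cap hi

/-- A whole one-coloured context can be normalised at once, since representatives of its parts can
be exchanged for the parts up to joinability. This makes both sides of a rule instance comparable.
-/
theorem nf_subst {X : Type*} {p : L.Term X} (hp : S.Pure c p) (σ : X → L.Term V) :
    S.nf (p.subst σ) = (S.rep c (p.subst fun x => S.cap c (S.nf (σ x)))).subst id := by
  induction p with
  | var x => rw [subst_var, subst_var, (canonical_nf _).rep_cap, flatten_cap]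
  | func f ts ih =>
    obtain rfl : S.colour ⟨_, f⟩ = c := hp.1
    have hpure (i) : S.Pure (S.colour ⟨_, f⟩) ((ts i).subst fun x => S.cap (S.colour ⟨_, f⟩) (S.nf (σ x))) :=
      (isTermOver_subst (hp.2 i)).2 fun x _ => pure_cap _
    have hcap (i) : S.cap (S.colour ⟨_, f⟩) (S.nf ((ts i).subst σ))
        = S.rep (S.colour ⟨_, f⟩) ((ts i).subst fun x => S.cap (S.colour ⟨_, f⟩) (S.nf (σ x))) := by
      rw [ih i (hp.2 i)]
      refine cap_flatten_rep (hpure i) fun a ha => ?_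
      obtain ⟨x, -, ha⟩ := mem_vars_subst.1 ha
      exact not_rooted_of_mem_vars_cap ha
    simp only [subst_func, nf, hcap]
    congr 1
    exact rep_eq_rep (c := S.colour ⟨_, f⟩) ⟨rfl, fun i => pure_rep (hpure i)⟩ ⟨rfl, hpure⟩
      (.func f fun i => (joinable_rep (hpure i)).symm)

/-- Rewriting does not change the normal form. -/
theorem nf_eq_of_stepOn {s t : L.Term V} (h : StepOn (⋃ d, S.rules d) s t) :
    S.nf s = S.nf t := by
  induction h with
  | @root l r hlr σ =>
    obtain ⟨c, hc⟩ := Set.mem_iUnion.1 hlr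
    rw [nf_subst (S.lhs_over c _ hc), nf_subst (S.rhs_over c _ hc)]
    congr 1
    exact rep_eq_rep ((isTermOver_subst (S.lhs_over c _ hc)).2 fun x _ => pure_cap _)
      ((isTermOver_subst (S.rhs_over c _ hc)).2 fun x _ => pure_cap _)
      (joinable_of_reflTransGen (.single (.root hc _)))
  | @arg n f ts i t h ih =>
    have (j : Fin n) : S.nf (Function.update ts i t j) = S.nf (ts j) := by
      by_cases hj : j = i
      · subst hj
        rw [Function.update_self, ih]
      · rw [Function.update_of_ne hj]
    simp only [nf, this]

theorem nf_eq_of_reflTransGen {s t : L.Term V}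
    (h : ReflTransGen (StepOn (⋃ d, S.rules d)) s t) : S.nf s = S.nf t := by
  induction h with
  | refl => rfl
  | tail _ h ih => exact ih.trans (nf_eq_of_stepOn h)

theorem pure_subst_nf (s : L.Term V) :
    S.Pure c ((S.cap c s).subst fun a => (.var (S.nf a) : L.Term (L.Term V))) :=
  (isTermOver_subst (pure_cap s)).2 fun _ _ => trivial

/-- If no alien fuses with the layer after normalisation, the top layer of the normal form depends
only on the layer with its aliens abstracted to their normal forms. -/
theorem cap_nf {s : L.Term V} (h : ∀ a ∈ vars (S.cap c s), ¬ S.Rooted c (S.nf a)) :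
    S.cap c (S.nf s) = S.rep c ((S.cap c s).subst fun a => .var (S.nf a)) := by
  have hs := nf_subst (pure_cap s) (S := S) (c := c) id
  simp only [id] at hs
  rw [flatten_cap, subst_congr (τ := fun a => .var (S.nf a))
    fun a ha => cap_of_not_rooted (h a ha)] at hs
  rw [hs]
  refine cap_flatten_rep (pure_subst_nf s) fun b hb => ?_
  obtain ⟨a, ha, hb⟩ := mem_vars_subst.1 hb
  rw [mem_vars_var] at hb
  exact hb ▸ h a ha

/-! ### Reduced terms -/

variable (S) in
/-- The root of the term and, hereditarily, the roots of its aliens have the same colours as the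
roots of their normal forms. The number bounds the number of layers. -/
def Reduced : ℕ → L.Term V → Prop
  | 0, _ => False
  | n + 1, t => ∀ c, (S.Rooted c t ↔ S.Rooted c (S.nf t)) ∧
      (S.Rooted c t → ∀ a ∈ vars (S.cap c t), Reduced n a)

theorem Reduced.rooted_iff {n : ℕ} {t : L.Term V} (h : S.Reduced n t) :
    S.Rooted c t ↔ S.Rooted c (S.nf t) := by
  cases n with
  | zero => exact h.elim
  | succ n => exact (h c).1

theorem Reduced.succ {n : ℕ} : ∀ {t : L.Term V}, S.Reduced n t → S.Reduced (n + 1) t := by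
  induction n with
  | zero => exact fun h => h.elim
  | succ n ih => exact fun h c => ⟨(h c).1, fun hc a ha => ih ((h c).2 hc a ha)⟩

theorem Reduced.mono {m n : ℕ} (hmn : m ≤ n) {t : L.Term V} (h : S.Reduced m t) :
    S.Reduced n t := by
  induction hmn with
  | refl => exact h
  | step _ ih => exact ih.succ

theorem reduced_var {x : V} : S.Reduced 1 (.var x) := fun _ => ⟨Iff.rfl, fun h => h.elim⟩

theorem Reduced.of_mem_vars_cap {n : ℕ} {t a : L.Term V} (h : S.Reduced n t)
    (ha : a ∈ vars (S.cap c t)) : S.Reduced n a := by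
  by_cases hc : S.Rooted c t
  · cases n with
    | zero => exact h.elim
    | succ n => exact ((h c).2 hc a ha).succ
  · rw [cap_of_not_rooted hc, mem_vars_var] at ha
    exact ha ▸ h

/-- If the root did not have colour `c`, the term would be its own alien, hence reduced, with a root
colour differing from that of its normal form. -/
theorem reduced_of_rooted_nf {n : ℕ} {t : L.Term V} (h : S.Rooted c (S.nf t))
    (ha : ∀ a ∈ vars (S.cap c t), S.Reduced n a) : S.Reduced (n + 1) t := by
  have hc : S.Rooted c t := by
    by_contra hc
    have := ha t (by simp [cap_of_not_rooted hc])
    exact hc (this.rooted_iff.2 h)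
  intro d
  refine ⟨⟨fun hd => hc.unique hd ▸ h, fun hd => h.unique hd ▸ hc⟩, fun hd => ?_⟩
  obtain rfl := hc.unique hd
  exact ha

theorem Reduced.stepOn {n : ℕ} : ∀ {s t : L.Term V}, S.Reduced n s →
    StepOn (⋃ d, S.rules d) s t → S.Reduced n t := by
  induction n with
  | zero => exact fun h => h.elim
  | succ n ih =>
    intro s t hs hst
    cases s with
    | var x =>
      refine (not_stepOn_var (fun ρ hρ => ?_) hst).elim
      obtain ⟨c, hc⟩ := Set.mem_iUnion.1 hρ
      exact S.lhs_not_var c ρ hc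
    | func f ts =>
      have hroot : S.Rooted (S.colour ⟨_, f⟩) (.func f ts) := rfl
      refine reduced_of_rooted_nf (nf_eq_of_stepOn hst ▸ hs.rooted_iff.1 hroot) fun b hb => ?_
      obtain ⟨a, ha, rfl | ⟨b', hab, hb⟩⟩ := exists_mem_vars_cap_of_stepOn hst hb
      · exact (hs _).2 hroot a ha
      · exact (ih ((hs _).2 hroot a ha) hab).of_mem_vars_cap hb

theorem Reduced.reflTransGen {n : ℕ} {s t : L.Term V} (hs : S.Reduced n s)
    (h : ReflTransGen (StepOn (⋃ d, S.rules d)) s t) : S.Reduced n t := by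
  induction h with
  | refl => exact hs
  | tail _ h ih => exact ih.stepOn h

/-- Rules need not be left-linear, so equal variables of an abstracted layer must be instantiated by
the same term; `φ` picks that term for each normal form. -/
theorem exists_common_reduct {n : ℕ}
    (hn : ∀ s t : L.Term V, S.Reduced n s → S.Reduced n t → S.nf s = S.nf t →
      Join (ReflTransGen (StepOn (⋃ d, S.rules d))) s t)
    {A : Set (L.Term V)} (hfin : A.Finite) (hA : ∀ a ∈ A, S.Reduced n a) :
    ∃ φ : L.Term V → L.Term V,
      ∀ a ∈ A, ReflTransGen (StepOn (⋃ d, S.rules d)) a (φ (S.nf a)) := by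
  -- The second clause keeps `e` reduced with normal form `k`, so that `hn` can join it with the
  -- next alien.
  have key (k : L.Term V) : ∃ e, (∀ a ∈ A, S.nf a = k →
      ReflTransGen (StepOn (⋃ d, S.rules d)) a e) ∧
        ((∃ a ∈ A, S.nf a = k) → S.Reduced n e ∧ S.nf e = k) := by
    induction A, hfin using Set.Finite.induction_on with
    | empty => exact ⟨k, by simp⟩
    | @insert a A _ _ ih =>
      obtain ⟨e, he, he'⟩ := ih fun b hb => hA b (.inr hb)
      have ha := hA a (.inl rfl)
      by_cases hak : S.nf a = k
      swap
      · refine ⟨e, ?_, ?_⟩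
        · rintro b (rfl | hb) hbk
          · exact (hak hbk).elim
          · exact he b hb hbk
        · rintro ⟨b, rfl | hb, hbk⟩
          · exact (hak hbk).elim
          · exact he' ⟨b, hb, hbk⟩
      · by_cases hex : ∃ b ∈ A, S.nf b = k
        · obtain ⟨j, haj, hej⟩ := hn a e ha (he' hex).1 (hak.trans (he' hex).2.symm)
          refine ⟨j, ?_, fun _ => ⟨ha.reflTransGen haj, ?_⟩⟩
          · rintro b (rfl | hb) hbk
            · exact haj
            · exact (he b hb hbk).trans hej
          · rw [← nf_eq_of_reflTransGen haj, hak]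
        · refine ⟨a, ?_, fun _ => ⟨ha, hak⟩⟩
          rintro b (rfl | hb) hbk
          · exact .refl
          · exact (hex ⟨b, hb, hbk⟩).elim
  choose φ hφ using key
  exact ⟨φ, fun a ha => (hφ _).1 a ha rfl⟩

/-- A rewrite sequence on abstracted layers lifts to terms, once the aliens with the same normal
form have been reduced to the same term. -/
theorem reflTransGen_of_layer {φ : L.Term V → L.Term V} {s : L.Term V} {p : L.Term (L.Term V)}
    (hφ : ∀ a ∈ vars (S.cap c s), ReflTransGen (StepOn (⋃ d, S.rules d)) a (φ (S.nf a)))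
    (hp : ReflTransGen (StepOn (S.rules c)) ((S.cap c s).subst fun a => .var (S.nf a)) p) :
    ReflTransGen (StepOn (⋃ d, S.rules d)) s (p.subst φ) := by
  have h₁ := reflTransGen_subst_subst (t := S.cap c s) (σ := id) (τ := fun a => φ (S.nf a)) hφ
  have h₂ := reflTransGen_subst hp φ
  rw [flatten_cap] at h₁
  rw [subst_subst] at h₂
  exact h₁.trans (h₂.lift id fun _ _ h => h.mono (Set.subset_iUnion S.rules c))

theorem join_of_reduced {n : ℕ} : ∀ {s t : L.Term V}, S.Reduced n s → S.Reduced n t →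
    S.nf s = S.nf t → Join (ReflTransGen (StepOn (⋃ d, S.rules d))) s t := by
  induction n with
  | zero => exact fun h => h.elim
  | succ n ih =>
    intro s t hs ht hst
    by_cases hroot : ∃ c, S.Rooted c s
    · obtain ⟨c, hc⟩ := hroot
      have hc' : S.Rooted c t := ht.rooted_iff.2 (hst ▸ hs.rooted_iff.1 hc)
      have hsn := (hs c).2 hc
      have htn := (ht c).2 hc'
      have hcaps : S.cap c (S.nf s) = _ := cap_nf fun a ha =>
        fun h => not_rooted_of_mem_vars_cap ha ((hsn a ha).rooted_iff.2 h)
      have hcapt : S.cap c (S.nf t) = _ := cap_nf fun a ha =>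
        fun h => not_rooted_of_mem_vars_cap ha ((htn a ha).rooted_iff.2 h)
      -- Equal normal forms have equal top layers, so the abstracted layers of `s` and `t` have the
      -- same representative.
      obtain ⟨p, hsp, htp⟩ := joinable_of_rep_eq_rep (pure_subst_nf s) (pure_subst_nf t)
        (hcaps.symm.trans ((congrArg _ hst).trans hcapt))
      obtain ⟨φ, hφ⟩ := exists_common_reduct (fun _ _ => ih)
        ((finite_vars (S.cap c s)).union (finite_vars (S.cap c t)))
        fun a ha => ha.elim (hsn a) (htn a)
      exact ⟨p.subst φ, reflTransGen_of_layer (fun a ha => hφ a (.inl ha)) hsp,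
        reflTransGen_of_layer (fun a ha => hφ a (.inr ha)) htp⟩
    · cases s with
      | func f ts => exact (hroot ⟨_, rfl⟩).elim
      | var x =>
        cases t with
        | func f ts => exact (hroot ⟨_, hs.rooted_iff.2 (hst ▸ ht.rooted_iff.1 rfl)⟩).elim
        | var y =>
          rw [show (Term.var x : L.Term V) = .var y from hst]
          exact ⟨_, .refl, .refl⟩

/-- Reduce the arguments first. If the root then disagrees with the normal form, the abstracted
layer is joinable with a variable, hence rewrites to it; lifting this collapses the term to a reduct
of one of its reduced aliens. -/
theorem exists_reduced (t : L.Term V) :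
    ∃ t', ReflTransGen (StepOn (⋃ d, S.rules d)) t t' ∧ ∃ n, S.Reduced n t' := by
  induction t with
  | var x => exact ⟨_, .refl, 1, reduced_var⟩
  | @func k f ts ih =>
    choose us hus n hn using ih
    set c := S.colour ⟨_, f⟩ with hc
    set s : L.Term V := .func f us with hs
    have hts : ReflTransGen (StepOn (⋃ d, S.rules d)) (.func f ts) s := reflTransGen_func f hus
    have haliens : ∀ a ∈ vars (S.cap c s), S.Reduced (Finset.univ.sup n) a := by
      intro a ha
      rw [hs, cap_func hc.symm] at ha
      obtain ⟨i, hi⟩ := mem_vars_func.1 ha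
      exact ((hn i).mono (Finset.le_sup (Finset.mem_univ i))).of_mem_vars_cap hi
    by_cases hroot : S.Rooted c (S.nf s)
    · exact ⟨s, hts, _, reduced_of_rooted_nf hroot haliens⟩
    · have hcap : S.cap c (S.nf s) = _ := cap_nf fun a ha =>
        fun h => not_rooted_of_mem_vars_cap ha ((haliens a ha).rooted_iff.2 h)
      rw [cap_of_not_rooted hroot] at hcap
      have hj := joinable_rep (pure_subst_nf (S := S) (c := c) s)
      rw [← hcap] at hj
      have hred := hj.reflTransGen_var
      obtain ⟨φ, hφ⟩ := exists_common_reduct (fun _ _ => join_of_reduced)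
        (finite_vars (S.cap c s)) haliens
      -- Rewriting creates no variables, so the variable reached is the normal form of an alien `a`.
      obtain ⟨a, ha, has⟩ := mem_vars_subst.1
        (vars_subset_of_reflTransGen (S.vars_subset c) hred (mem_vars_var.2 rfl))
      rw [mem_vars_var] at has
      refine ⟨φ (S.nf s), hts.trans (reflTransGen_of_layer hφ hred), _,
        (haliens a ha).reflTransGen ?_⟩
      rw [has]
      exact hφ a ha

theorem join_of_reflTransGen {a b c : L.Term V}
    (hab : ReflTransGen (StepOn (⋃ d, S.rules d)) a b)
    (hac : ReflTransGen (StepOn (⋃ d, S.rules d)) a c) :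
    Join (ReflTransGen (StepOn (⋃ d, S.rules d))) b c := by
  obtain ⟨b', hb, m, hm⟩ := exists_reduced (S := S) b
  obtain ⟨c', hc, n, hn⟩ := exists_reduced (S := S) c
  obtain ⟨e, hbe, hce⟩ := join_of_reduced (hm.mono (le_max_left m n))
    (hn.mono (le_max_right m n))
    ((nf_eq_of_reflTransGen (hab.trans hb)).symm.trans (nf_eq_of_reflTransGen (hac.trans hc)))
  exact ⟨e, hb.trans hbe, hc.trans hce⟩

end ColouredSystem
end TermRewriting

/-! ### Toyama's theorem -/

open TermRewriting in
theorem mainTheorem6 {L : FirstOrder.Language.{u, v}} {V : Type w}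
    [Countable V] [Infinite V] (R₁ R₂ : TermRewriting.TRS L V)
    (hdisj : R₁.sig ∩ R₂.sig = ∅) (h₁ : R₁.IsConfluent) (h₂ : R₂.IsConfluent) :
    (R₁.union R₂).IsConfluent := by
  classical
  have hne : Nonempty (L.Term V) := ⟨.var (Classical.arbitrary V)⟩
  -- Symbols outside both signatures get the colour `none`, with no rules; all terms are then
  -- covered.
  let colour : Sym L → Option Bool := fun f =>
    if f ∈ R₁.sig then some true else if f ∈ R₂.sig then some false else none
  have hsig₁ : {f | colour f = some true} = R₁.sig := by
    ext f
    simp only [colour, Set.mem_ofPred_eq]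
    split_ifs <;> simp_all
  have hsig₂ : {f | colour f = some false} = R₂.sig := by
    ext f
    have : f ∈ R₁.sig → f ∉ R₂.sig := fun h h' => (hdisj ▸ ⟨h, h'⟩ : f ∈ (∅ : Set (Sym L)))
    simp only [colour, Set.mem_ofPred_eq]
    split_ifs <;> simp_all
  let S : ColouredSystem L V (Option Bool) :=
    { colour
      rules := fun | some true => R₁.rules | some false => R₂.rules | none => ∅
      lhs_over := by
        rintro (_ | _ | _)
        · exact fun _ h => h.elim
        · exact hsig₂ ▸ R₂.lhs_over
        · exact hsig₁ ▸ R₁.lhs_over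
      rhs_over := by
        rintro (_ | _ | _)
        · exact fun _ h => h.elim
        · exact hsig₂ ▸ R₂.rhs_over
        · exact hsig₁ ▸ R₁.rhs_over
      lhs_not_var := by
        rintro (_ | _ | _)
        · exact fun _ h => h.elim
        · exact R₂.lhs_not_var
        · exact R₁.lhs_not_var
      vars_subset := by
        rintro (_ | _ | _)
        · exact fun _ h => h.elim
        · exact R₂.vars_subset
        · exact R₁.vars_subset
      confluent := by
        rintro (_ | _ | _)
        · have hno {s t : L.Term (L.Term V)} :
              ¬ StepOn (∅ : Set (L.Term V × L.Term V)) s t := by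
            intro h
            induction h with
            | root h => exact h
            | arg _ _ _ _ ih => exact ih
          intro a b c _ hab hac
          rw [← Relation.ReflTransGen.cases_head_iff.1 hab |>.resolve_right
            fun ⟨_, h, _⟩ => hno h]
          exact ⟨c, hac, .refl⟩
        · exact hsig₂ ▸ (TRS.isConfluent_iff.1 h₂).of_infinite R₂.vars_subset
        · exact hsig₁ ▸ (TRS.isConfluent_iff.1 h₁).of_infinite R₁.vars_subset }
  have hunion : (⋃ d, S.rules d) = (R₁.union R₂).rules := by
    ext ρ
    simp [S, TRS.union, Option.exists, or_comm]
  rw [TRS.isConfluent_iff, ← hunion]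
  exact fun a b c _ => S.join_of_reflTransGen
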